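/- Let $J=J_{2n}=\begin{bmatrix}0&I_n\\-I_n&0\end{bmatrix}$ and let $S\in M_{2n}(\mathbb C)$ be symplectic, i.e. $S^TJS=J$ (with the transpose $^T$, not the conjugate transpose). Let $\lambda_1\in\sigma(S)$ and $\mu\in\mathbb C\setminus\{0\}$. The Segre characteristic of $S$ for $\lambda_1$ is the list, in non-increasing order and with repetitions, of the sizes of the Jordan blocks with eigenvalue $\lambda_1$ in a Jordan form of $S$ (such a form exists). Then the following are equivalent: (a) there exist eigenvectors $x_1,x_2\in\mathbb C^{2n}$ of $S$ for $\lambda_1$ and $\lambda_1^{-1}$, respectively, with $X^TJX=J_2$ for $X=[\,x_1\ x_2\,]$ (i.e. the hypotheses of the structure-preserving modification $S\mapsto S+XC^T$ of the eigenvalue pair $\lambda_1,\lambda_1^{-1}$ into $\mu,\mu^{-1}$ can be met); (b) there exist eigenvectors $x_1,x_2\in\mathbb C^{2n}$ of $S$ for $\lambda_1$ and $\lambda_1^{-1}$, respectively, with $x_1^TJx_2\neq0$; (c) the Segre characteristic of $S$ for $\lambda_1$ contains a one, that is, $S$ has a Jordan block of size $1\times1$ for $\lambda_1$; equivalently, the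 Segre characteristic has the form $((\star,\dots,\star,1))$. Moreover, if $x_1$ and $x_2$ are any eigenvectors of $S$ for $\lambda_1$ and $\lambda_1^{-1}$, respectively, with $x_1^TJx_2\neq0$, then both belong to trivial Jordan chains of $S$: every Jordan chain of $S$ for $\lambda_1$ containing $x_1$, and every Jordan chain of $S$ for $\lambda_1^{-1}$ containing $x_2$, has length one. Here a Jordan chain of length $p\ge1$ for $\lambda$ is a tuple $y_1,\dots,y_p$ with $y_1\ne0$, $(S-\lambda I)y_1=0$ and $(S-\lambda I)y_{k+1}=y_k$ for $1\le k<p$. -/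

import Mathlib

open Matrix

noncomputable section

/-- The `2n × 2n` matrix `J = [0, I; -I, 0]`. (Mathlib's `Matrix.J` has the opposite sign.)
The `2n` indices are `Fin n ⊕ Fin n`. -/
def sympJ (n : ℕ) : Matrix (Fin n ⊕ Fin n) (Fin n ⊕ Fin n) ℂ :=
  Matrix.fromBlocks 0 1 (-1) 0

/-- `S` is (complex) symplectic: `Sᵀ J S = J`, with the transpose, not the conjugate transpose. -/
def IsSymplectic {n : ℕ} (S : Matrix (Fin n ⊕ Fin n) (Fin n ⊕ Fin n) ℂ) : Prop :=
  Sᵀ * sympJ n * S = sympJ n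

/-- `x` is an eigenvector of the matrix `A` for the eigenvalue `lam` (in particular `x ≠ 0`). -/
def IsEigenvector {m : Type*} [Fintype m] (A : Matrix m m ℂ) (lam : ℂ) (x : m → ℂ) : Prop :=
  x ≠ 0 ∧ A *ᵥ x = lam • x

/-- The upper triangular `k × k` Jordan block with eigenvalue `lam`. -/
def jordanBlock (k : ℕ) (lam : ℂ) : Matrix (Fin k) (Fin k) ℂ :=
  Matrix.of fun i j => if i = j then lam else if i.val + 1 = j.val then 1 else 0

/-- The matrix `A` is similar to the block diagonal matrix whose diagonal blocks are the Jordan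
blocks of (positive) size `size i` with eigenvalue `eig i`, `i = 1, …, r`. The bijection `e` only
numbers the rows and columns of that block diagonal matrix. -/
def IsJordanForm {m : Type*} [Fintype m] [DecidableEq m] (A : Matrix m m ℂ) {r : ℕ}
    (size : Fin r → ℕ) (eig : Fin r → ℂ) : Prop :=
  (∀ i, 0 < size i) ∧
    ∃ (e : (Σ i : Fin r, Fin (size i)) ≃ m) (F : Matrix m m ℂ), IsUnit F ∧
      F⁻¹ * A * F =
        Matrix.reindex e e (Matrix.blockDiagonal' fun i => jordanBlock (size i) (eig i))

/-- `s` is the Segre characteristic of `A` for `lam`: the list, in non-increasing order and with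
repetitions, of the sizes of the Jordan blocks with eigenvalue `lam` in a Jordan form of `A`. -/
def IsSegreCharacteristic {m : Type*} [Fintype m] [DecidableEq m] (A : Matrix m m ℂ) (lam : ℂ)
    (s : List ℕ) : Prop :=
  ∃ (r : ℕ) (size : Fin r → ℕ) (eig : Fin r → ℂ), IsJordanForm A size eig ∧
    s = ((Finset.univ.filter fun i => eig i = lam).val.map size).sort (· ≥ ·)

/-- `y 0, …, y (p - 1)` is a Jordan chain of length `p ≥ 1` of `A` for `lam`:
`y 0 ≠ 0`, `(A - lam I) (y 0) = 0` and `(A - lam I) (y (k + 1)) = y k`. -/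
def IsJordanChain {m : Type*} [Fintype m] (A : Matrix m m ℂ) (lam : ℂ) {p : ℕ}
    (y : Fin p → m → ℂ) : Prop :=
  ∃ hp : 0 < p, IsEigenvector A lam (y ⟨0, hp⟩) ∧
    ∀ (k : ℕ) (hk : k + 1 < p),
      A *ᵥ y ⟨k + 1, hk⟩ - lam • y ⟨k + 1, hk⟩ = y ⟨k, Nat.lt_of_succ_lt hk⟩

/-- `x` belongs to a trivial Jordan chain of `A` for `lam`: it lies on a Jordan chain for `lam`,
and no Jordan chain for `lam` on which it lies has length `≥ 2`. (Every eigenvector forms by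
itself a chain of length one; the point is that this chain cannot be prolonged.) -/
def BelongsToTrivialChain {m : Type*} [Fintype m] (A : Matrix m m ℂ) (lam : ℂ)
    (x : m → ℂ) : Prop :=
  (∃ (p : ℕ) (y : Fin p → m → ℂ), IsJordanChain A lam y ∧ x ∈ Set.range y) ∧
    ∀ (p : ℕ) (y : Fin p → m → ℂ), IsJordanChain A lam y → x ∈ Set.range y → p = 1

/-- The `2n × 2` matrix `[x₁ x₂]` with columns `x₁` and `x₂`. -/
def twoCols {m : Type*} (x₁ x₂ : m → ℂ) : Matrix m (Fin 1 ⊕ Fin 1) ℂ :=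
  Matrix.of fun i => Sum.elim (fun _ => x₁ i) (fun _ => x₂ i)

/-- The hypotheses of the symplectic rank-two modification that moves the eigenvalue pair
`lam, lam⁻¹` of `S` to `mu, mu⁻¹`: `S` is symplectic, `mu ≠ 0`, and there are eigenvectors
`x₁`, `x₂` of `S` for `lam` and `lam⁻¹` with `Xᵀ J X = J₂`, where `X = [x₁ x₂]`. -/
def ModificationApplicable {n : ℕ} (S : Matrix (Fin n ⊕ Fin n) (Fin n ⊕ Fin n) ℂ)
    (lam mu : ℂ) : Prop :=
  IsSymplectic S ∧ mu ≠ 0 ∧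
    ∃ x₁ x₂ : Fin n ⊕ Fin n → ℂ, IsEigenvector S lam x₁ ∧ IsEigenvector S lam⁻¹ x₂ ∧
      (twoCols x₁ x₂)ᵀ * sympJ n * twoCols x₁ x₂ = sympJ 1

end

/-! Write B(x, y) = xᵀJy, a nondegenerate alternating form preserved by S. If Sz = λ⁻¹z, then B(Sy,
z) = λB(Sy, Sz) = λB(y, z), so the range of S - λ is B-orthogonal to the λ⁻¹-eigenspace
(`IsSymplectic.sub_smul_dotProduct_eq_zero`). Conversely, a vector outside this range is separated
from it by a functional B(·, z), and such a z satisfies Sz = λ⁻¹z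
(`IsSymplectic.exists_dotProduct_ne_zero`). Hence (b) says that ker(S - λ) is not contained in
range(S - λ).

This condition is invariant under similarity, and on a Jordan matrix it means a 1 × 1 block for λ
(`exists_size_eq_one_iff`). It also makes the chains trivial: an eigenvector outside the range
cannot be prolonged. Finally, (a) and (b) differ only by a scaling of x₂. -/

/-! ### Existence of Jordan bases -/

open Polynomial in
/-- The powers `(X - a)^(e - 1), …, X - a, 1` form a basis of `K[X] / I` for `I = ((X - a)^e)`. -/
theorem exists_basis_quotient_X_sub_C_pow {K : Type*} [Field K] (a : K) (e : ℕ) (I : Ideal K[X])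
    (hI : I = Ideal.span {(X - C a) ^ e}) :
    ∃ b : Module.Basis (Fin e) K (K[X] ⧸ I),
      ∀ j : Fin e, b j = Ideal.Quotient.mk I ((X - C a) ^ (e - 1 - j.val)) := by
  subst hI
  set I := Ideal.span {(X - C a) ^ e} with hI
  let v : Fin e → K[X] ⧸ I := fun j => Ideal.Quotient.mk I ((X - C a) ^ (e - 1 - j.val))
  have hspan : ⊤ ≤ Submodule.span K (Set.range v) := by
    rintro q -
    obtain ⟨f, rfl⟩ := Ideal.Quotient.mk_surjective q
    -- Taylor expansion at `a`: the terms of degree at least `e` vanish in the quotient.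
    rw [← sum_taylor_eq f a, Polynomial.sum, map_sum]
    refine Submodule.sum_mem _ fun i _ => ?_
    rw [← smul_eq_C_mul, ← Ideal.Quotient.mkₐ_eq_mk K, map_smul, Ideal.Quotient.mkₐ_eq_mk]
    refine Submodule.smul_mem _ _ ?_
    by_cases hi : i < e
    · refine Submodule.subset_span ⟨⟨e - 1 - i, by omega⟩, ?_⟩
      simp only [v]
      congr 2
      omega
    · rw [Ideal.Quotient.eq_zero_iff_mem.2
        (Ideal.mem_span_singleton.2 (pow_dvd_pow _ (not_lt.1 hi)))]
      exact Submodule.zero_mem _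
  have hcard : Fintype.card (Fin e) = Module.finrank K (K[X] ⧸ I) := by
    rw [finrank_quotient_span_eq_natDegree, natDegree_pow, natDegree_X_sub_C]
    simp
  exact ⟨basisOfTopLeSpanOfCardEqFinrank v hspan hcard, fun j => by simp [v]⟩

/-- A Jordan basis of `f`: `f (b ⟨i, j⟩) = eig i • b ⟨i, j⟩ + b ⟨i, j - 1⟩`, the last term being
absent for `j = 0`. -/
def IsJordanBasis {K V ι : Type*} [Field K] [AddCommGroup V] [Module K V] (f : Module.End K V)
    (size : ι → ℕ) (eig : ι → K) (b : Module.Basis (Σ i, Fin (size i)) K V) : Prop :=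
  ∀ (i : ι) (j : Fin (size i)), f (b ⟨i, j⟩) = eig i • b ⟨i, j⟩ +
    if 0 < j.val then b ⟨i, ⟨j.val - 1, lt_of_le_of_lt (Nat.sub_le _ _) j.isLt⟩⟩ else 0

-- With X acting as `f`, V is a torsion K[X]-module, hence a direct sum of quotients K[X]/(pᵉ) with
-- p associated to some X - a. Multiplication by X - a lowers the index in the basis of powers. An
-- exponent e = 0 is not excluded, so blocks may be empty.
open Polynomial in
theorem exists_isJordanBasis.{u, v} {K : Type u} {V : Type v} [Field K] [IsAlgClosed K] [AddCommGroup V] [Module K V]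
    [FiniteDimensional K V] (f : Module.End K V) :
    ∃ (ι : Type u) (_ : Fintype ι) (size : ι → ℕ) (eig : ι → K)
      (b : Module.Basis (Σ i, Fin (size i)) K V), IsJordanBasis f size eig b := by
  classical
  obtain ⟨ι, hι, p, hp, e, ⟨φ⟩⟩ := Module.equiv_directSum_of_isTorsion
    (Module.AEval.isTorsion_of_finiteDimensional K V f)
  have hroot : ∀ i, ∃ a : K, Associated (p i) (X - C a) := by
    intro i
    have hd := IsAlgClosed.degree_eq_one_of_irreducible K (hp i)
    obtain ⟨a, ha⟩ := exists_root_of_degree_eq_one hd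
    exact ⟨a, ((irreducible_X_sub_C a).associated_of_dvd (hp i) (dvd_iff_isRoot.2 ha)).symm⟩
  choose eig heig using hroot
  have hbasis := fun i => exists_basis_quotient_X_sub_C_pow (eig i) (e i)
    (Submodule.span K[X] {p i ^ e i})
    (Ideal.span_singleton_eq_span_singleton.2 ((heig i).pow_pow))
  choose c hc using hbasis
  let ψ : (∀ i, K[X] ⧸ Submodule.span K[X] {p i ^ e i}) ≃ₗ[K[X]] Module.AEval K V f :=
    (φ.trans (DirectSum.linearEquivFunOnFintype K[X] ι _)).symm
  let b := ((Pi.basis c).map (ψ.restrictScalars K)).map (Module.AEval.of K V f).symm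
  refine ⟨ι, hι, e, eig, b, fun i j => ?_⟩
  let θ := ψ.toLinearMap ∘ₗ LinearMap.single K[X] _ i
  have hb : ∀ k : Fin (e i), b ⟨i, k⟩ = (Module.AEval.of K V f).symm (θ (c i k)) := by
    intro k
    simp [b, θ, Pi.basis_apply]
  have hX : f (b ⟨i, j⟩) = (Module.AEval.of K V f).symm (θ ((X : K[X]) • c i j)) := by
    rw [hb, θ.map_smul, Module.AEval.of_symm_X_smul]
    rfl
  have key : (X : K[X]) • c i j = eig i • c i j +
      if 0 < j.val then c i ⟨j.val - 1, lt_of_le_of_lt (Nat.sub_le _ _) j.isLt⟩ else 0 := by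
    have h1 : (X : K[X]) • c i j = eig i • c i j + (X - C (eig i)) • c i j := by
      rw [sub_smul, ← algebraMap_eq, algebraMap_smul]
      abel
    rw [h1]
    congr 1
    rw [hc, ← Ideal.Quotient.mk_eq_mk, ← Submodule.Quotient.mk_smul, smul_eq_mul, ← pow_succ']
    have := j.isLt
    split_ifs with hj
    · rw [hc, ← Ideal.Quotient.mk_eq_mk]
      congr 2
      simp only
      omega
    · rw [Submodule.Quotient.mk_eq_zero]
      refine Ideal.mem_span_singleton.2 ?_
      rw [(by omega : e i - 1 - j.val + 1 = e i)]
      exact ((heig i).pow_pow).dvd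
  rw [hX, key, map_add, map_add, θ.map_smul_of_tower, map_smul, ← hb j]
  congr 1
  split_ifs
  · rw [hb]
  · simp

/-- The blocks of a Jordan basis can be taken nonempty and numbered by `Fin r`. -/
theorem exists_isJordanBasis_fin {K V : Type*} [Field K] [IsAlgClosed K] [AddCommGroup V]
    [Module K V] [FiniteDimensional K V] (f : Module.End K V) :
    ∃ (r : ℕ) (size : Fin r → ℕ) (eig : Fin r → K)
      (b : Module.Basis (Σ i, Fin (size i)) K V),
      (∀ i, 0 < size i) ∧ IsJordanBasis f size eig b := by
  classical
  obtain ⟨ι, hι, size, eig, b, hb⟩ := exists_isJordanBasis f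
  let g := (Fintype.equivFin {i : ι // 0 < size i}).symm
  let s : (Σ k, Fin (size (g k).1)) ≃ Σ i, Fin (size i) :=
    { toFun := fun x => ⟨(g x.1).1, x.2⟩
      invFun := fun x => ⟨g.symm ⟨x.1, x.2.pos⟩, Fin.cast (by simp) x.2⟩
      left_inv := by
        rintro ⟨k, j⟩
        have hk : g.symm ⟨(g k).1, j.pos⟩ = k := by simp
        refine Sigma.ext hk ?_
        rw [Fin.heq_ext_iff (by simp)]
        simp
      right_inv := by
        rintro ⟨i, j⟩
        refine Sigma.ext (by simp) ?_
        rw [Fin.heq_ext_iff (by simp)]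
        simp }
  refine ⟨_, fun k => size (g k).1, fun k => eig (g k).1, b.reindex s.symm,
    fun k => (g k).2, fun k j => ?_⟩
  simpa [s] using hb (g k).1 j

/-! ### Jordan matrices and the Segre characteristic -/

theorem blockDiagonal'_mulVec_apply {o R : Type*} {d : o → Type*} [Fintype o] [DecidableEq o]
    [∀ i, Fintype (d i)] [NonUnitalNonAssocSemiring R] (M : ∀ i, Matrix (d i) (d i) R)
    (x : (Σ i, d i) → R) (i : o) (j : d i) :
    (blockDiagonal' M *ᵥ x) ⟨i, j⟩ = (M i *ᵥ fun k => x ⟨i, k⟩) j := by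
  simp only [mulVec, dotProduct]
  rw [Fintype.sum_sigma, Finset.sum_eq_single i]
  · simp
  · intro i' _ hi'
    refine Finset.sum_eq_zero fun k _ => ?_
    rw [blockDiagonal'_apply_ne M _ _ (Ne.symm hi'), zero_mul]
  · simp

theorem jordanBlock_mulVec_apply (k : ℕ) (lam : ℂ) (x : Fin k → ℂ) (j : Fin k) :
    (jordanBlock k lam *ᵥ x) j =
      lam * x j + if h : j.val + 1 < k then x ⟨j.val + 1, h⟩ else 0 := by
  have hsplit : ∀ i, jordanBlock k lam j i * x i =
      (if j = i then lam * x i else 0) + if j.val + 1 = i.val then x i else 0 := by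
    intro i
    by_cases h : j = i
    · subst h
      simp [jordanBlock]
    · simp [jordanBlock, h]
  simp only [mulVec, dotProduct, hsplit, Finset.sum_add_distrib, Finset.sum_ite_eq,
    Finset.mem_univ, if_true]
  congr 1
  split_ifs with h
  · rw [Finset.sum_eq_single ⟨j.val + 1, h⟩]
    · simp
    · intro i _ hi
      exact if_neg fun h' => hi (Fin.ext h'.symm)
    · simp
  · exact Finset.sum_eq_zero fun i _ => if_neg fun h' => h (by omega)

/-- The block diagonal matrix with Jordan blocks of size `size i` and eigenvalue `eig i`. -/
noncomputable abbrev jordanMatrix {r : ℕ} (size : Fin r → ℕ) (eig : Fin r → ℂ) :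
    Matrix (Σ i, Fin (size i)) (Σ i, Fin (size i)) ℂ :=
  blockDiagonal' fun i => jordanBlock (size i) (eig i)

theorem jordanMatrix_mulVec_apply {r : ℕ} (size : Fin r → ℕ) (eig : Fin r → ℂ)
    (x : (Σ i, Fin (size i)) → ℂ) (i : Fin r) (j : Fin (size i)) :
    (jordanMatrix size eig *ᵥ x) ⟨i, j⟩ =
      eig i * x ⟨i, j⟩ + if h : j.val + 1 < size i then x ⟨i, ⟨j.val + 1, h⟩⟩ else 0 := by
  rw [blockDiagonal'_mulVec_apply, jordanBlock_mulVec_apply]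

theorem exists_isJordanForm {m : Type*} [Fintype m] [DecidableEq m] (A : Matrix m m ℂ) :
    ∃ (r : ℕ) (size : Fin r → ℕ) (eig : Fin r → ℂ), IsJordanForm A size eig := by
  obtain ⟨r, size, eig, b, hpos, hb⟩ := exists_isJordanBasis_fin (toLin' A)
  let e := b.indexEquiv (Pi.basisFun ℂ m)
  let F := (Pi.basisFun ℂ m).toMatrix (b.reindex e)
  refine ⟨r, size, eig, hpos, e, F, ?_, ?_⟩
  · exact ⟨⟨F, (b.reindex e).toMatrix (Pi.basisFun ℂ m),
      Module.Basis.toMatrix_mul_toMatrix_flip _ _, Module.Basis.toMatrix_mul_toMatrix_flip _ _⟩, rfl⟩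
  · have hinv : F⁻¹ = (b.reindex e).toMatrix (Pi.basisFun ℂ m) :=
      inv_eq_left_inv (Module.Basis.toMatrix_mul_toMatrix_flip _ _)
    have hA : A = LinearMap.toMatrix (Pi.basisFun ℂ m) (Pi.basisFun ℂ m) (toLin' A) := by
      rw [LinearMap.toMatrix_eq_toMatrix', LinearMap.toMatrix'_toLin']
    rw [hinv]
    conv_lhs => rw [hA]
    rw [basis_toMatrix_mul_linearMap_toMatrix_mul_basis_toMatrix]
    ext k l
    obtain ⟨⟨i, j⟩, rfl⟩ := e.surjective k
    obtain ⟨⟨i', j'⟩, rfl⟩ := e.surjective l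
    have hrepr : ∀ p q, (b.reindex e).repr (b p) (e q) = if p = q then 1 else 0 := by
      intro p q
      rw [Module.Basis.repr_reindex_apply, e.symm_apply_apply, Module.Basis.repr_self,
        Finsupp.single_apply]
    rw [LinearMap.toMatrix_apply, Module.Basis.reindex_apply, e.symm_apply_apply, hb i' j',
      map_add, map_smul, Finsupp.add_apply, Finsupp.smul_apply, hrepr, apply_ite (b.reindex e).repr,
      map_zero, apply_ite (fun g : m →₀ ℂ => g (e ⟨i, j⟩)), Finsupp.zero_apply, hrepr, reindex_apply, submatrix_apply, e.symm_apply_apply,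
      e.symm_apply_apply]
    by_cases hi : i' = i
    · subst hi
      rw [blockDiagonal'_apply_eq]
      simp only [jordanBlock, of_apply, Sigma.mk.injEq, heq_eq_eq, true_and, Fin.ext_iff]
      split_ifs <;> first | omega | simp
    · rw [blockDiagonal'_apply_ne _ _ _ (Ne.symm hi)]
      simp [hi]

theorem IsJordanForm.exists_linearEquiv {m : Type*} [Fintype m] [DecidableEq m]
    {A : Matrix m m ℂ} {r : ℕ} {size : Fin r → ℕ} {eig : Fin r → ℂ}
    (h : IsJordanForm A size eig) :
    ∃ φ : ((Σ i, Fin (size i)) → ℂ) ≃ₗ[ℂ] (m → ℂ),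
      ∀ x, A *ᵥ φ x = φ (jordanMatrix size eig *ᵥ x) := by
  obtain ⟨-, e, F, hF, hD⟩ := h
  have hdet := (isUnit_iff_isUnit_det F).1 hF
  let ψ : (m → ℂ) ≃ₗ[ℂ] (m → ℂ) := LinearEquiv.ofLinearMap (toLin' F) (toLin' F⁻¹)
    (by rw [← toLin'_mul, mul_nonsing_inv _ hdet, toLin'_one])
    (by rw [← toLin'_mul, nonsing_inv_mul _ hdet, toLin'_one])
  refine ⟨(LinearEquiv.funCongrLeft ℂ ℂ e.symm).trans ψ, fun x => ?_⟩
  have hAF : A * F = F * reindex e e (jordanMatrix size eig) := by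
    rw [← hD, mul_assoc, mul_nonsing_inv_cancel_left _ _ hdet]
  change A *ᵥ (F *ᵥ (x ∘ e.symm)) = F *ᵥ ((jordanMatrix size eig *ᵥ x) ∘ e.symm)
  rw [mulVec_mulVec, hAF, ← mulVec_mulVec, reindex_apply, submatrix_mulVec_equiv]
  simp [Function.comp_assoc]

/-- A Jordan matrix has a `1 × 1` block for `lam` iff some vector in the kernel of
`jordanMatrix - lam` is not in its range. -/
theorem exists_size_eq_one_iff {r : ℕ} (size : Fin r → ℕ) (eig : Fin r → ℂ) (lam : ℂ) :
    (∃ i, eig i = lam ∧ size i = 1) ↔ ∃ x, jordanMatrix size eig *ᵥ x = lam • x ∧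
      ∀ y, jordanMatrix size eig *ᵥ y - lam • y ≠ x := by
  constructor
  · rintro ⟨i, hi, h1⟩
    refine ⟨Pi.single ⟨i, ⟨0, by omega⟩⟩ 1, ?_, fun y hy => ?_⟩
    · ext ⟨i', j'⟩
      rw [jordanMatrix_mulVec_apply]
      by_cases h : i' = i
      · subst h
        have := j'.isLt
        rw [dif_neg (by omega), hi]
        simp
      · have hz : ∀ j'', (Pi.single ⟨i, ⟨0, by omega⟩⟩ 1 : (Σ i, Fin (size i)) → ℂ) ⟨i', j''⟩ = 0 :=
          fun j'' => Pi.single_eq_of_ne (fun h' => h (congrArg Sigma.fst h')) _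
        simp [hz]
    · have := congrFun hy ⟨i, ⟨0, by omega⟩⟩
      rw [Pi.sub_apply, jordanMatrix_mulVec_apply, dif_neg (by simp [h1]), hi] at this
      simp at this
  · rintro ⟨x, hx, hy⟩
    by_contra hno
    push Not at hno
    have hx' : ∀ i (j : Fin (size i)), eig i * x ⟨i, j⟩ +
        (if h : j.val + 1 < size i then x ⟨i, ⟨j.val + 1, h⟩⟩ else 0) = lam * x ⟨i, j⟩ := by
      intro i j
      rw [← jordanMatrix_mulVec_apply, hx]
      simp
    -- A kernel vector vanishes on blocks with another eigenvalue: induction from the last index of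
    -- the block backwards.
    have hzero : ∀ i, eig i ≠ lam → ∀ (d : ℕ) (j : Fin (size i)), size i - j.val = d →
        x ⟨i, j⟩ = 0 := by
      intro i hi d
      induction d with
      | zero => intro j hj; omega
      | succ d ih =>
        intro j hj
        have h := hx' i j
        have h0 : (if h : j.val + 1 < size i then x ⟨i, ⟨j.val + 1, h⟩⟩ else 0) = 0 := by
          split_ifs
          · exact ih _ (by simp only; omega)
          · rfl
        rw [h0, add_zero] at h
        by_contra hne
        exact hi (mul_right_cancel₀ hne h)
    -- A preimage of `x`: shift `x` by one index inside each block for `lam`.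
    refine hy (fun p => if eig p.1 = lam then
      (if 0 < p.2.val then x ⟨p.1, ⟨p.2.val - 1, lt_of_le_of_lt (Nat.sub_le _ _) p.2.isLt⟩⟩ else 0)
      else 0) ?_
    ext ⟨i, j⟩
    rw [Pi.sub_apply, jordanMatrix_mulVec_apply]
    by_cases hi : eig i = lam
    · have h1 := hno i hi
      have hj := j.isLt
      by_cases hlast : j.val + 1 < size i
      · simp [hi, hlast]
      -- The shift misses the last index, but `x` is zero there: the block has size at least two,
      -- and the kernel equation one index earlier applies.
      · have h := hx' i ⟨j.val - 1, by omega⟩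
        rw [hi, dif_pos (by simp only; omega)] at h
        have hje : (⟨j.val - 1 + 1, by omega⟩ : Fin (size i)) = j := Fin.ext (by simp only; omega)
        simp only [hje] at h
        simp [hi, hlast, (add_eq_left.1 h)]
    · simp [hi, hzero i hi _ j rfl]

theorem IsSegreCharacteristic.one_mem_iff {m : Type*} [Fintype m] [DecidableEq m]
    {A : Matrix m m ℂ} {lam : ℂ} {s : List ℕ} (hs : IsSegreCharacteristic A lam s) :
    1 ∈ s ↔ ∃ x, A *ᵥ x = lam • x ∧ ∀ y, A *ᵥ y - lam • y ≠ x := by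
  obtain ⟨r, size, eig, hJ, rfl⟩ := hs
  obtain ⟨φ, hφ⟩ := hJ.exists_linearEquiv
  have : 1 ∈ ((Finset.univ.filter fun i => eig i = lam).val.map size).sort (· ≥ ·) ↔
      ∃ i, eig i = lam ∧ size i = 1 := by
    rw [Multiset.mem_sort, Multiset.mem_map]
    simp
  rw [this, exists_size_eq_one_iff]
  constructor
  · rintro ⟨x, hx, hy⟩
    refine ⟨φ x, by rw [hφ, hx, map_smul], fun y h => hy (φ.symm y) (φ.injective ?_)⟩
    rw [map_sub, ← hφ, map_smul, φ.apply_symm_apply, h]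
  · rintro ⟨x, hx, hy⟩
    refine ⟨φ.symm x, φ.injective ?_, fun y h => hy (φ y) ?_⟩
    · rw [← hφ, map_smul, φ.apply_symm_apply, hx]
    · rw [hφ, ← map_smul, ← map_sub, h, φ.apply_symm_apply]

theorem IsSegreCharacteristic.one_mem_iff_exists_append {m : Type*} [Fintype m] [DecidableEq m]
    {A : Matrix m m ℂ} {lam : ℂ} {s : List ℕ} (hs : IsSegreCharacteristic A lam s) :
    1 ∈ s ↔ ∃ t : List ℕ, s = t ++ [1] := by
  obtain ⟨r, size, eig, ⟨hpos, -⟩, hs⟩ := hs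
  have hsort : s.Pairwise (· ≥ ·) := hs ▸ Multiset.pairwise_sort _ _
  have hp : ∀ k ∈ s, 0 < k := by
    intro k hk
    rw [hs, Multiset.mem_sort, Multiset.mem_map] at hk
    obtain ⟨i, -, rfl⟩ := hk
    exact hpos i
  constructor
  · intro h1
    have hne : s ≠ [] := List.ne_nil_of_mem h1
    refine ⟨s.dropLast, ?_⟩
    have hlast : s.getLast hne = 1 := by
      refine le_antisymm ?_ (hp _ (List.getLast_mem hne))
      have hd := List.dropLast_append_getLast hne
      rw [← hd] at h1 hsort
      rw [List.pairwise_append] at hsort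
      rcases List.mem_append.1 h1 with h | h
      · exact hsort.2.2 _ h _ (by simp)
      · exact (List.mem_singleton.1 h).ge
    rw [← hlast, List.dropLast_append_getLast hne]
  · rintro ⟨t, rfl⟩
    simp

/-! ### The symplectic form and eigenvectors -/

theorem sympJ_mul_sympJ (n : ℕ) : sympJ n * sympJ n = -1 := by
  simp [sympJ, fromBlocks_multiply, ← fromBlocks_one, fromBlocks_neg]

theorem transpose_sympJ (n : ℕ) : (sympJ n)ᵀ = -sympJ n := by
  simp [sympJ, fromBlocks_transpose, fromBlocks_neg]

theorem dotProduct_sympJ_mulVec_comm {n : ℕ} (x y : Fin n ⊕ Fin n → ℂ) :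
    x ⬝ᵥ (sympJ n *ᵥ y) = -(y ⬝ᵥ (sympJ n *ᵥ x)) := by
  rw [dotProduct_mulVec, ← mulVec_transpose, transpose_sympJ, neg_mulVec, neg_dotProduct,
    dotProduct_comm]

theorem IsSymplectic.dotProduct_mulVec_mulVec {n : ℕ} {S : Matrix (Fin n ⊕ Fin n) (Fin n ⊕ Fin n) ℂ}
    (hS : IsSymplectic S) (x y : Fin n ⊕ Fin n → ℂ) :
    (S *ᵥ x) ⬝ᵥ (sympJ n *ᵥ (S *ᵥ y)) = x ⬝ᵥ (sympJ n *ᵥ y) := by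
  conv_rhs => rw [← hS]
  rw [← mulVec_mulVec, ← mulVec_mulVec, dotProduct_mulVec x, vecMul_transpose]

theorem IsSymplectic.isUnit {n : ℕ} {S : Matrix (Fin n ⊕ Fin n) (Fin n ⊕ Fin n) ℂ}
    (hS : IsSymplectic S) : IsUnit S := by
  refine IsUnit.of_mul_eq_one_right (-(sympJ n * (Sᵀ * sympJ n))) ?_
  rw [neg_mul, mul_assoc, hS, sympJ_mul_sympJ, neg_neg]

theorem IsSymplectic.ne_zero_of_mem_spectrum {n : ℕ}
    {S : Matrix (Fin n ⊕ Fin n) (Fin n ⊕ Fin n) ℂ} (hS : IsSymplectic S) {lam : ℂ}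
    (hlam : lam ∈ spectrum ℂ S) : lam ≠ 0 := by
  rintro rfl
  exact spectrum.zero_notMem ℂ hS.isUnit hlam

theorem IsSymplectic.sub_smul_dotProduct_eq_zero {n : ℕ}
    {S : Matrix (Fin n ⊕ Fin n) (Fin n ⊕ Fin n) ℂ} (hS : IsSymplectic S) {lam : ℂ}
    (hlam : lam ≠ 0) {z : Fin n ⊕ Fin n → ℂ} (hz : S *ᵥ z = lam⁻¹ • z) (y : Fin n ⊕ Fin n → ℂ) :
    (S *ᵥ y - lam • y) ⬝ᵥ (sympJ n *ᵥ z) = 0 := by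
  have h := hS.dotProduct_mulVec_mulVec y z
  rw [hz, mulVec_smul, dotProduct_smul, smul_eq_mul, inv_mul_eq_iff_eq_mul₀ hlam] at h
  rw [sub_dotProduct, h, smul_dotProduct, smul_eq_mul, sub_self]

/-- An eigenvector for `lam` pairs nontrivially with an eigenvector for `lam⁻¹` as soon as it is
not in the range of `S - lam`. -/
theorem IsSymplectic.exists_dotProduct_ne_zero {n : ℕ}
    {S : Matrix (Fin n ⊕ Fin n) (Fin n ⊕ Fin n) ℂ} (hS : IsSymplectic S) {lam : ℂ}
    (hlam : lam ≠ 0) {x : Fin n ⊕ Fin n → ℂ} (hx : ∀ y, S *ᵥ y - lam • y ≠ x) :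
    ∃ z, S *ᵥ z = lam⁻¹ • z ∧ x ⬝ᵥ (sympJ n *ᵥ z) ≠ 0 := by
  have hx' : x ∉ LinearMap.range (mulVecLin S - lam • LinearMap.id) := by
    rintro ⟨y, hy⟩
    exact hx y (by simpa using hy)
  obtain ⟨f, hfx, hf⟩ := Submodule.exists_dual_map_eq_bot_of_notMem hx' inferInstance
  let w : Fin n ⊕ Fin n → ℂ := fun i => f (Pi.single i 1)
  have hw : ∀ v, f v = v ⬝ᵥ w := by
    intro v
    conv_lhs => rw [← Finset.univ_sum_single v]
    rw [map_sum]
    refine Finset.sum_congr rfl fun i _ => ?_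
    have : Pi.single i (v i) = v i • (Pi.single i 1 : Fin n ⊕ Fin n → ℂ) := by
      rw [← Pi.single_smul, smul_eq_mul, mul_one]
    rw [this, map_smul, smul_eq_mul]
  -- Since J² = -1, this choice makes `f` equal to B(·, z).
  let z := -(sympJ n *ᵥ w)
  have hJz : sympJ n *ᵥ z = w := by
    rw [mulVec_neg, mulVec_mulVec, sympJ_mul_sympJ, neg_mulVec, one_mulVec, neg_neg]
  have hrange : ∀ y, (S *ᵥ y) ⬝ᵥ w = lam * (y ⬝ᵥ w) := by
    intro y
    have : f (S *ᵥ y - lam • y) = 0 := by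
      rw [← Submodule.mem_bot ℂ, ← hf]
      exact Submodule.mem_map_of_mem ⟨y, by simp⟩
    rwa [hw, sub_dotProduct, smul_dotProduct, smul_eq_mul, sub_eq_zero] at this
  refine ⟨z, ?_, by rwa [hJz, ← hw]⟩
  -- It suffices to test against vectors Sy, as S is invertible; there B(Sy, Sz) = B(y, z) =
  -- λ⁻¹B(Sy, z).
  have hker : sympJ n *ᵥ (S *ᵥ z - lam⁻¹ • z) = 0 := by
    refine dotProduct_eq_zero _ fun v => ?_
    obtain ⟨y, rfl⟩ := (mulVec_surjective_iff_isUnit.2 hS.isUnit) v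
    rw [dotProduct_comm, mulVec_sub, mulVec_smul, hJz, dotProduct_sub,
      hS.dotProduct_mulVec_mulVec, hJz, dotProduct_smul, hrange, smul_eq_mul,
      inv_mul_cancel_left₀ hlam, sub_self]
  have := congrArg (sympJ n *ᵥ ·) hker
  simp only [mulVec_mulVec, sympJ_mul_sympJ, neg_mulVec, one_mulVec, mulVec_zero] at this
  exact sub_eq_zero.1 (neg_eq_zero.1 this)

theorem IsSymplectic.exists_eigenvectors_iff {n : ℕ}
    {S : Matrix (Fin n ⊕ Fin n) (Fin n ⊕ Fin n) ℂ} (hS : IsSymplectic S) {lam : ℂ}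
    (hlam : lam ≠ 0) :
    (∃ x₁ x₂ : Fin n ⊕ Fin n → ℂ, IsEigenvector S lam x₁ ∧ IsEigenvector S lam⁻¹ x₂ ∧
      x₁ ⬝ᵥ (sympJ n *ᵥ x₂) ≠ 0) ↔
    ∃ x, S *ᵥ x = lam • x ∧ ∀ y, S *ᵥ y - lam • y ≠ x := by
  constructor
  · rintro ⟨x₁, x₂, h₁, h₂, hne⟩
    refine ⟨x₁, h₁.2, ?_⟩
    rintro y rfl
    exact hne (hS.sub_smul_dotProduct_eq_zero hlam h₂.2 y)
  · rintro ⟨x, hx, hy⟩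
    obtain ⟨z, hz, hne⟩ := hS.exists_dotProduct_ne_zero hlam hy
    refine ⟨x, z, ⟨?_, hx⟩, ⟨?_, hz⟩, hne⟩
    · rintro rfl
      simp at hne
    · rintro rfl
      simp at hne

/-- B is alternating, so one off-diagonal entry determines the whole 2 × 2 matrix. -/
theorem twoCols_transpose_mul_sympJ_mul {n : ℕ} (x₁ x₂ : Fin n ⊕ Fin n → ℂ) :
    (twoCols x₁ x₂)ᵀ * sympJ n * twoCols x₁ x₂ = sympJ 1 ↔ x₁ ⬝ᵥ (sympJ n *ᵥ x₂) = 1 := by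
  have hself : ∀ x : Fin n ⊕ Fin n → ℂ, x ⬝ᵥ (sympJ n *ᵥ x) = 0 := fun x =>
    self_eq_neg.1 (dotProduct_sympJ_mulVec_comm x x)
  have hentry : ∀ a b, ((twoCols x₁ x₂)ᵀ * sympJ n * twoCols x₁ x₂) a b =
      (twoCols x₁ x₂).col a ⬝ᵥ (sympJ n *ᵥ (twoCols x₁ x₂).col b) := by
    intro a b
    rw [Matrix.mul_assoc]
    rfl
  have hl : ∀ i, (twoCols x₁ x₂).col (Sum.inl i) = x₁ := fun _ => rfl
  have hr : ∀ i, (twoCols x₁ x₂).col (Sum.inr i) = x₂ := fun _ => rfl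
  constructor
  · intro h
    have := congrFun (congrFun h (Sum.inl 0)) (Sum.inr 0)
    rw [hentry, hl, hr] at this
    simpa [sympJ] using this
  · intro h
    ext (i | i) (j | j) <;> rw [hentry] <;>
      simp only [hl, hr, hself, h, dotProduct_sympJ_mulVec_comm x₂ x₁] <;>
      simp [sympJ, Subsingleton.elim i j]

theorem modificationApplicable_iff {n : ℕ} {S : Matrix (Fin n ⊕ Fin n) (Fin n ⊕ Fin n) ℂ}
    (hS : IsSymplectic S) (lam : ℂ) {mu : ℂ} (hmu : mu ≠ 0) :
    ModificationApplicable S lam mu ↔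
      ∃ x₁ x₂ : Fin n ⊕ Fin n → ℂ, IsEigenvector S lam x₁ ∧ IsEigenvector S lam⁻¹ x₂ ∧
        x₁ ⬝ᵥ (sympJ n *ᵥ x₂) ≠ 0 := by
  constructor
  · rintro ⟨-, -, x₁, x₂, h₁, h₂, h⟩
    refine ⟨x₁, x₂, h₁, h₂, ?_⟩
    rw [(twoCols_transpose_mul_sympJ_mul x₁ x₂).1 h]
    exact one_ne_zero
  · rintro ⟨x₁, x₂, h₁, h₂, h⟩
    refine ⟨hS, hmu, x₁, (x₁ ⬝ᵥ (sympJ n *ᵥ x₂))⁻¹ • x₂, h₁,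
      ⟨smul_ne_zero (inv_ne_zero h) h₂.1, ?_⟩, ?_⟩
    · rw [mulVec_smul, h₂.2, smul_comm]
    · rw [twoCols_transpose_mul_sympJ_mul, mulVec_smul, dotProduct_smul, smul_eq_mul,
        inv_mul_cancel₀ h]

/-! ### Trivial Jordan chains and the theorem -/

/-- An eigenvector outside the range of `A - lam` belongs to a trivial Jordan chain. -/
theorem IsEigenvector.belongsToTrivialChain {m : Type*} [Fintype m] {A : Matrix m m ℂ} {lam : ℂ}
    {x : m → ℂ} (hx : IsEigenvector A lam x) (hr : ∀ y, A *ᵥ y - lam • y ≠ x) :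
    BelongsToTrivialChain A lam x := by
  refine ⟨⟨1, fun _ => x, ⟨one_pos, hx, fun k hk => by omega⟩, ⟨0, rfl⟩⟩, ?_⟩
  rintro p y ⟨hp, h0, hy⟩ ⟨⟨k, hk⟩, rfl⟩
  by_contra hp1
  -- Not being in the range, the eigenvector is last in its chain. If p ≠ 1 it has a predecessor,
  -- which is its image under A - λ, hence zero; but chain vectors are nonzero.
  have hlast : k + 1 = p := by
    by_contra hne
    exact hr _ (hy k (by omega))
  obtain ⟨k, rfl⟩ : ∃ l, k = l + 1 := ⟨k - 1, by omega⟩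
  have hne : ∀ (l : ℕ) (hl : l < p), y ⟨l, hl⟩ ≠ 0 := by
    intro l
    induction l with
    | zero => exact fun _ => h0.1
    | succ l ih =>
      intro hl hz
      refine ih (by omega) ?_
      rw [← hy l hl, hz]
      simp
  refine hne k (by omega) ?_
  rw [← hy k hk, hx.2, sub_self]

theorem IsSymplectic.belongsToTrivialChain {n : ℕ}
    {S : Matrix (Fin n ⊕ Fin n) (Fin n ⊕ Fin n) ℂ} (hS : IsSymplectic S) {lam : ℂ}
    (hlam : lam ≠ 0) {x z : Fin n ⊕ Fin n → ℂ} (hx : IsEigenvector S lam x)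
    (hz : IsEigenvector S lam⁻¹ z) (hne : x ⬝ᵥ (sympJ n *ᵥ z) ≠ 0) :
    BelongsToTrivialChain S lam x := by
  refine hx.belongsToTrivialChain ?_
  rintro y rfl
  exact hne (hS.sub_smul_dotProduct_eq_zero hlam hz.2 y)

theorem theorem2p2 (n : ℕ) (S : Matrix (Fin n ⊕ Fin n) (Fin n ⊕ Fin n) ℂ)
    (hS : IsSymplectic S) (lam : ℂ) (hlam : lam ∈ spectrum ℂ S) (mu : ℂ) (hmu : mu ≠ 0) :
    -- applicability means: eigenvectors with a nonzero product exist
    (ModificationApplicable S lam mu ↔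
      ∃ x₁ x₂ : Fin n ⊕ Fin n → ℂ, IsEigenvector S lam x₁ ∧ IsEigenvector S lam⁻¹ x₂ ∧
        x₁ ⬝ᵥ (sympJ n *ᵥ x₂) ≠ 0) ∧
    -- there is a Segre characteristic, and the criterion holds for it
    (∃ s : List ℕ, IsSegreCharacteristic S lam s) ∧
    (∀ s : List ℕ, IsSegreCharacteristic S lam s →
      ((∃ x₁ x₂ : Fin n ⊕ Fin n → ℂ, IsEigenvector S lam x₁ ∧ IsEigenvector S lam⁻¹ x₂ ∧
          x₁ ⬝ᵥ (sympJ n *ᵥ x₂) ≠ 0) ↔ 1 ∈ s) ∧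
      (1 ∈ s ↔ ∃ t : List ℕ, s = t ++ [1])) ∧
    -- such eigenvectors always belong to trivial Jordan chains
    (∀ x₁ x₂ : Fin n ⊕ Fin n → ℂ, IsEigenvector S lam x₁ → IsEigenvector S lam⁻¹ x₂ →
      x₁ ⬝ᵥ (sympJ n *ᵥ x₂) ≠ 0 →
      BelongsToTrivialChain S lam x₁ ∧ BelongsToTrivialChain S lam⁻¹ x₂) := by
  have h0 := hS.ne_zero_of_mem_spectrum hlam
  refine ⟨modificationApplicable_iff hS lam hmu, ?_, fun s hs => ⟨?_, ?_⟩, ?_⟩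
  · obtain ⟨r, size, eig, h⟩ := exists_isJordanForm S
    exact ⟨_, r, size, eig, h, rfl⟩
  · rw [hS.exists_eigenvectors_iff h0, hs.one_mem_iff]
  · exact hs.one_mem_iff_exists_append
  · intro x₁ x₂ h₁ h₂ hne
    refine ⟨hS.belongsToTrivialChain h0 h₁ h₂ hne,
      hS.belongsToTrivialChain (inv_ne_zero h0) h₂ (by rwa [inv_inv]) ?_⟩
    rwa [dotProduct_sympJ_mulVec_comm, neg_ne_zero]
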